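/- Let $\mathcal H$ be a separable infinite-dimensional complex Hilbert space, $\mathcal L(\mathcal H)$ the space of bounded linear operators on $\mathcal H$, and $\mathbb D$ the open unit disc in $\mathbb C$. For an analytic function $\phi:\mathbb D\to\mathcal L(\mathcal H)$ put $(D\phi)(z)=z\phi'(z)+\phi(z)$. Let $\mathcal O_1(\mathcal H)$ denote the set of $\mathcal H$-valued functions $f$ that are analytic on some disc, centered at the origin, of radius strictly larger than $1$, and that satisfy $\|f\|_{H^2(\mathcal H)}^2=\sum_{n=0}^\infty\|\hat f(n)\|_{\mathcal H}^2=1$, where $\hat f(n)$ is the $n$th Taylor coefficient of $f$ at the origin. Let $dA$ denote area measure on $\mathbb C$. Then there exists a bounded analytic function $\phi:\mathbb D\to\mathcal L(\mathcal H)$ (bounded in operator norm) such that $$\sup_{f\in\mathcal O_1(\mathcal H)}\int_{\mathbb D}\|(D\phi)(z)f(z)\|_{\mathcal H}^2\,(1-|z|^2)\,dA(z)<\infty,$$ while $$\sup_{f\in\mathcal O_1(\mathcal H)}\int_{\mathbb D}\|(D\phi)(z)f(\bar z)\|_{\mathcal H}^2\,(1-|z|^2)\,dA(z)=\infty.$$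 -/

import Mathlib

open MeasureTheory Metric
open scoped ENNReal ComplexConjugate

noncomputable section

/-- The `n`-th Taylor coefficient at the origin of a vector-valued function. -/
def taylorCoeff {Y : Type*} [NormedAddCommGroup Y] [NormedSpace ℂ Y] (f : ℂ → Y) (n : ℕ) : Y :=
  ((n.factorial : ℂ)⁻¹) • iteratedDeriv n f 0

/-- The square of the Hardy space norm on `H²(Y)`, `Y` a Hilbert space, as an element of `[0, ∞]`:
the sum of the squared norms of the Taylor coefficients. -/
def hardyNormSq {Y : Type*} [NormedAddCommGroup Y] [NormedSpace ℂ Y] (f : ℂ → Y) : ℝ≥0∞ :=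
  ∑' n : ℕ, ‖taylorCoeff f n‖ₑ ^ 2

/-- The set of `H²(Y)`-normalized functions that are analytic on some disc, centered at the origin,
that is strictly larger than the unit disc. -/
def normalizedAnalytic (Y : Type*) [NormedAddCommGroup Y] [NormedSpace ℂ Y] : Set (ℂ → Y) :=
  {f | (∃ R : ℝ, 1 < R ∧ AnalyticOnNhd ℂ f (ball 0 R)) ∧ hardyNormSq f = 1}

/-- The differentiation operator `D f (z) = z f'(z) + f(z)`. -/
def diffOp {Y : Type*} [NormedAddCommGroup Y] [NormedSpace ℂ Y] (f : ℂ → Y) (z : ℂ) : Y :=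
  z • deriv f z + f z

/-- `sup_f ∫_𝔻 ‖(Dφ)(z) f(z)‖² (1 - |z|²) dA(z)`, as an element of `[0, ∞]`. -/
def analyticCarleson {H : Type*} [NormedAddCommGroup H] [InnerProductSpace ℂ H]
    (φ : ℂ → H →L[ℂ] H) : ℝ≥0∞ :=
  ⨆ f ∈ normalizedAnalytic H,
    ∫⁻ z in ball (0 : ℂ) 1, ENNReal.ofReal (‖diffOp φ z (f z)‖ ^ 2 * (1 - ‖z‖ ^ 2))

/-- `sup_f ∫_𝔻 ‖(Dφ)(z) f(z̄)‖² (1 - |z|²) dA(z)`, as an element of `[0, ∞]`. -/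
def antiAnalyticCarleson {H : Type*} [NormedAddCommGroup H] [InnerProductSpace ℂ H]
    (φ : ℂ → H →L[ℂ] H) : ℝ≥0∞ :=
  ⨆ f ∈ normalizedAnalytic H,
    ∫⁻ z in ball (0 : ℂ) 1, ENNReal.ofReal (‖diffOp φ z (f (conj z))‖ ^ 2 * (1 - ‖z‖ ^ 2))

end

/-!
Every bounded analytic symbol `φ` has a finite analytic embedding constant. By the product rule
`(Dφ) f = D(φ f) - z φ f'`; Parseval's identity on the disc (`lintegral_disc_norm_sq`) bounds the
weighted integral of `‖D g‖²` and of `‖z g'‖²` by `π` times the square of the `H²` norm of `g`, and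
Parseval's identity on circles gives `‖φ f‖_{H²} ≤ sup ‖φ‖ ‖f‖_{H²}` (`hardyNormSq_clm_apply_le`).
The result is `analyticCarleson_le`. It remains to find a bounded analytic symbol whose
anti-analytic embedding constant is infinite.

Fix an orthonormal sequence `e`, a bounded operator `T` with `⟪e i, T (e j)⟫ = 1 / (i - j)` (the
Hilbert matrix, `exists_hilbert_matrix`) and let `D(z)` be the diagonal contraction
`e i ↦ z ^ 2 ^ i • e i`. The symbol is `φ(z) = D(z) T D(z)`, which is bounded by `‖T‖` on the disc.
For the normalized function `f(z) = M ^ (-1/2) ∑_{j < M} z ^ 2 ^ j • e j` the `i`-th coordinate of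
`(Dφ)(z) f(z̄)` has modulus, with `s = |z|²`,
`M ^ (-1/2) * s ^ (2 ^ i / 2) * |∑_{j < M} (2 ^ i + 2 ^ j + 1) * s ^ 2 ^ j / (i - j)|`.
When `1 - s` is comparable to `2 ^ (-i)` the factor `s ^ 2 ^ j` is bounded below for `j < i`, and it
beats the growth of `2 ^ j` for `j > i`. Thus the sum acts as a triangular truncation of the Hilbert
matrix: the terms with `j < i` add up to at least a constant times `2 ^ i * log i`, and the others
cost only `O(2 ^ i)` (`le_hilbertRow`). Integrating over the annuli where `1 - s` is comparable to
`2 ^ (-i)`, for `M / 2 ≤ i < M`, gives a lower bound of order `(log M)²`, which is unbounded.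
-/

/-! ### Taylor coefficients and power series on a disc -/

section Taylor
variable {Y : Type*} [NormedAddCommGroup Y] [NormedSpace ℂ Y]

theorem hasSum_taylorCoeff [CompleteSpace Y] {f : ℂ → Y} {R : ℝ} (hf : AnalyticOnNhd ℂ f (ball 0 R)) {z : ℂ}
    (hz : z ∈ ball (0 : ℂ) R) : HasSum (fun n : ℕ => z ^ n • taylorCoeff f n) (f z) := by
  have h := Complex.hasSum_taylorSeries_on_ball hf.differentiableOn hz
  convert! h using 2 with n
  rw [taylorCoeff, sub_zero, smul_comm]

theorem taylorCoeff_deriv (f : ℂ → Y) (n : ℕ) :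
    taylorCoeff (deriv f) n = ((n + 1 : ℕ) : ℂ) • taylorCoeff f (n + 1) := by
  rw [taylorCoeff, taylorCoeff, ← iteratedDeriv_succ', smul_smul]
  congr 1
  have h1 : ((n + 1 : ℕ) : ℂ) ≠ 0 := by exact_mod_cast n.succ_ne_zero
  have h2 : ((n.factorial : ℕ) : ℂ) ≠ 0 := by exact_mod_cast n.factorial_ne_zero
  rw [Nat.factorial_succ, Nat.cast_mul]
  field_simp

theorem hasSum_smul_deriv [CompleteSpace Y] {f : ℂ → Y} {R : ℝ} (hf : AnalyticOnNhd ℂ f (ball 0 R)) {z : ℂ}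
    (hz : z ∈ ball (0 : ℂ) R) :
    HasSum (fun n : ℕ => z ^ n • ((n : ℂ) • taylorCoeff f n)) (z • deriv f z) := by
  -- The term `n = 0` vanishes; the others form the Taylor series of `deriv f` times `z`.
  rw [← hasSum_nat_add_iff' 1]
  have h := (hasSum_taylorCoeff hf.deriv hz).const_smul z
  simp only [taylorCoeff_deriv] at h
  simpa [smul_smul, pow_succ', mul_assoc] using h

theorem hasSum_diffOp [CompleteSpace Y] {f : ℂ → Y} {R : ℝ} (hf : AnalyticOnNhd ℂ f (ball 0 R)) {z : ℂ}
    (hz : z ∈ ball (0 : ℂ) R) :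
    HasSum (fun n : ℕ => z ^ n • ((n + 1 : ℂ) • taylorCoeff f n)) (diffOp f z) := by
  convert! (hasSum_smul_deriv hf hz).add (hasSum_taylorCoeff hf hz) using 2 with n
  rw [add_smul, one_smul, smul_add]

/-- A power series that converges on the open disc converges absolutely there: its terms are bounded
on a slightly larger circle, which leaves a geometric series. -/
theorem summable_norm_mul_pow {a : ℕ → Y}
    (ha : ∀ z ∈ ball (0 : ℂ) 1, Summable fun n : ℕ => z ^ n • a n) {r : ℝ} (hr0 : 0 ≤ r)
    (hr : r < 1) : Summable fun n : ℕ => r ^ n * ‖a n‖ := by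
  obtain ⟨ρ, hrρ, hρ⟩ := exists_between hr
  have hρ0 : 0 < ρ := hr0.trans_lt hrρ
  have h := ha (ρ : ℂ) (by simpa [abs_of_pos hρ0] using hρ)
  obtain ⟨C, hC⟩ := h.tendsto_atTop_zero.norm.bddAbove_range
  refine Summable.of_nonneg_of_le (fun n => by positivity) (fun n => ?_)
    ((summable_geometric_of_lt_one (r := r / ρ) (by positivity)
      ((div_lt_one hρ0).2 hrρ)).mul_left C)
  have h1 : ρ ^ n * ‖a n‖ ≤ C := by
    have := hC (Set.mem_range_self n)
    simpa [norm_smul, abs_of_pos hρ0] using this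
  calc r ^ n * ‖a n‖ = (ρ ^ n * ‖a n‖) * (r / ρ) ^ n := by
        rw [div_pow]; field_simp
    _ ≤ C * (r / ρ) ^ n := by gcongr

end Taylor

/-! ### Parseval's identity on circles and on the disc -/

section Parseval
variable {H : Type*} [NormedAddCommGroup H] [InnerProductSpace ℂ H]

theorem integral_exp_int_mul (k : ℤ) :
    ∫ θ in (-Real.pi)..Real.pi, Complex.exp (k * θ * Complex.I) =
      if k = 0 then 2 * (Real.pi : ℂ) else 0 := by
  split_ifs with h
  · subst h
    simp; ring
  · have hk : (k * Complex.I : ℂ) ≠ 0 := by simp [h]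
    have := integral_exp_mul_complex (a := -Real.pi) (b := Real.pi) hk
    have e : ∀ θ : ℝ, (k * θ * Complex.I : ℂ) = k * Complex.I * θ := fun θ => by ring
    simp only [e, this]
    rw [div_eq_zero_iff]; left
    rw [sub_eq_zero, Complex.exp_eq_exp_iff_exists_int]
    exact ⟨k, by push_cast; ring⟩

/-- Parseval's identity on a circle for vector-valued polynomials. -/
theorem integral_norm_sq_sum (a : ℕ → H) (r : ℝ) (N : ℕ) :
    ∫ θ in (-Real.pi)..Real.pi,
      ‖∑ n ∈ Finset.range N, ((r : ℂ) * Complex.exp (θ * Complex.I)) ^ n • a n‖ ^ 2 =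
      ∑ n ∈ Finset.range N, 2 * Real.pi * (r ^ (2 * n) * ‖a n‖ ^ 2) := by
  have key : ∀ θ : ℝ, ((‖∑ n ∈ Finset.range N,
      ((r : ℂ) * Complex.exp (θ * Complex.I)) ^ n • a n‖ ^ 2 : ℝ) : ℂ) =
      ∑ n ∈ Finset.range N, ∑ m ∈ Finset.range N,
        Complex.exp (((m : ℤ) - (n : ℤ) : ℤ) * θ * Complex.I) *
          ((r : ℂ) ^ (n + m) * inner ℂ (a n) (a m)) := by
    intro θ
    rw [Complex.ofReal_pow]
    refine (inner_self_eq_norm_sq_to_K (𝕜 := ℂ) (∑ n ∈ Finset.range N,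
      ((r : ℂ) * Complex.exp (θ * Complex.I)) ^ n • a n)).symm.trans ?_
    rw [sum_inner]
    refine Finset.sum_congr rfl fun n _ => ?_
    rw [inner_sum]
    refine Finset.sum_congr rfl fun m _ => ?_
    rw [inner_smul_left, inner_smul_right, map_pow, map_mul, Complex.conj_ofReal,
      ← Complex.exp_conj, mul_pow, mul_pow, ← Complex.exp_nat_mul, ← Complex.exp_nat_mul]
    have : Complex.exp (((m : ℤ) - (n : ℤ) : ℤ) * θ * Complex.I) =
        Complex.exp (n * conj (θ * Complex.I)) * Complex.exp (m * (θ * Complex.I)) := by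
      rw [← Complex.exp_add]; congr 1; simp; ring
    rw [this]; ring
  apply Complex.ofReal_injective
  rw [← intervalIntegral.integral_ofReal]
  simp only [key]
  rw [intervalIntegral.integral_finsetSum]
  · push_cast
    refine Finset.sum_congr rfl fun n hn => ?_
    rw [intervalIntegral.integral_finsetSum]
    · simp_rw [intervalIntegral.integral_mul_const, ← Int.cast_natCast (R := ℂ), ← Int.cast_sub,
        integral_exp_int_mul]
      rw [Finset.sum_eq_single n]
      · simp [inner_self_eq_norm_sq_to_K, two_mul]
      · intro m _ hm
        rw [if_neg (by omega), zero_mul]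
      · exact fun h => absurd hn h
    · intro m _
      apply Continuous.intervalIntegrable
      fun_prop
  · intro n _
    apply Continuous.intervalIntegrable
    fun_prop

/-- Parseval's identity on a circle inside the disc of convergence, by dominated convergence from the
polynomial case. -/
theorem hasSum_integral_norm_sq {a : ℕ → H} {h : ℂ → H}
    (ha : ∀ z ∈ ball (0 : ℂ) 1, HasSum (fun n : ℕ => z ^ n • a n) (h z)) {r : ℝ} (hr0 : 0 ≤ r)
    (hr : r < 1) :
    HasSum (fun n : ℕ => 2 * Real.pi * (r ^ (2 * n) * ‖a n‖ ^ 2))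
      (∫ θ in (-Real.pi)..Real.pi, ‖h ((r : ℂ) * Complex.exp (θ * Complex.I))‖ ^ 2) := by
  have hs := summable_norm_mul_pow (fun z hz => (ha z hz).summable) hr0 hr
  rw [hasSum_iff_tendsto_nat_of_nonneg (fun n => by positivity)]
  simp only [← integral_norm_sq_sum]
  have hz : ∀ θ : ℝ, ‖(r : ℂ) * Complex.exp (θ * Complex.I)‖ = r := fun θ => by
    simp [Complex.norm_exp_ofReal_mul_I, abs_of_nonneg hr0]
  refine intervalIntegral.tendsto_integral_filter_of_dominated_convergence
    (fun _ => (∑' n : ℕ, r ^ n * ‖a n‖) ^ 2) ?_ ?_ ?_ ?_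
  · exact Filter.Eventually.of_forall fun N => by
      apply Continuous.aestronglyMeasurable; fun_prop
  · refine Filter.Eventually.of_forall fun N => Filter.Eventually.of_forall fun θ _ => ?_
    rw [norm_pow, norm_norm]
    gcongr
    refine (norm_sum_le _ _).trans ?_
    simp only [norm_smul, norm_pow, hz]
    exact hs.sum_le_tsum _ fun n _ => by positivity
  · simp
  · refine Filter.Eventually.of_forall fun θ _ => ?_
    exact ((ha _ (by rw [mem_ball_zero_iff, hz]; exact hr)).tendsto_sum_nat.norm).pow 2

theorem lintegral_circle_norm_sq {a : ℕ → H} {h : ℂ → H} (hc : ContinuousOn h (ball 0 1))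
    (ha : ∀ z ∈ ball (0 : ℂ) 1, HasSum (fun n : ℕ => z ^ n • a n) (h z)) {r : ℝ} (hr0 : 0 ≤ r)
    (hr : r < 1) :
    ∫⁻ θ in Set.Ioo (-Real.pi) Real.pi,
      ENNReal.ofReal (‖h ((r : ℂ) * Complex.exp (θ * Complex.I))‖ ^ 2) =
      ∑' n : ℕ, ENNReal.ofReal (2 * Real.pi * (r ^ (2 * n) * ‖a n‖ ^ 2)) := by
  have hs := hasSum_integral_norm_sq ha hr0 hr
  rw [← ENNReal.ofReal_tsum_of_nonneg (fun n => by positivity) hs.summable, hs.tsum_eq,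
    intervalIntegral.integral_of_le (by linarith [Real.pi_pos]), integral_Ioc_eq_integral_Ioo,
    ofReal_integral_eq_lintegral_ofReal]
  · have hc' : Continuous fun θ : ℝ => ‖h ((r : ℂ) * Complex.exp (θ * Complex.I))‖ ^ 2 := by
      refine (Continuous.norm ?_).pow 2
      refine hc.comp_continuous (by fun_prop) fun θ => ?_
      simp [Complex.norm_exp_ofReal_mul_I, abs_of_nonneg hr0, hr]
    exact (hc'.integrableOn_Icc).mono_set Set.Ioo_subset_Icc_self
  · exact Filter.Eventually.of_forall fun θ => by positivity

theorem integral_pow_mul_one_sub_sq (n : ℕ) :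
    ∫ r in (0 : ℝ)..1, r * (1 - r ^ 2) * r ^ (2 * n) = 1 / (2 * (((n : ℝ) + 1) * (n + 2))) := by
  have : ∀ r : ℝ, r * (1 - r ^ 2) * r ^ (2 * n) = r ^ (2 * n + 1) - r ^ (2 * n + 3) := by
    intro r; ring
  simp only [this]
  rw [intervalIntegral.integral_sub (by apply Continuous.intervalIntegrable; fun_prop)
    (by apply Continuous.intervalIntegrable; fun_prop), integral_pow, integral_pow]
  push_cast
  field_simp
  simp
  ring

/-- Parseval's identity on the disc with weight `1 - |z|²`, obtained by integrating the identity on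
circles in polar coordinates. -/
theorem lintegral_disc_norm_sq {a : ℕ → H} {h : ℂ → H} (hc : ContinuousOn h (ball 0 1))
    (ha : ∀ z ∈ ball (0 : ℂ) 1, HasSum (fun n : ℕ => z ^ n • a n) (h z)) :
    ∫⁻ z in ball (0 : ℂ) 1, ENNReal.ofReal (‖h z‖ ^ 2 * (1 - ‖z‖ ^ 2)) =
      ∑' n : ℕ, ENNReal.ofReal (Real.pi / ((n + 1) * (n + 2)) * ‖a n‖ ^ 2) := by
  set F : ℂ → ℝ≥0∞ := fun z => ENNReal.ofReal (‖h z‖ ^ 2 * (1 - ‖z‖ ^ 2)) with hF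
  have hFm : Measurable ((ball (0 : ℂ) 1).indicator F) := by
    classical
    rw [← Set.piecewise_eq_indicator]
    refine ContinuousOn.measurable_piecewise ?_ continuousOn_const measurableSet_ball
    exact ENNReal.continuous_ofReal.comp_continuousOn
      ((hc.norm.pow 2).mul (by fun_prop))
  rw [← lintegral_indicator measurableSet_ball, ← Complex.lintegral_comp_polarCoord_symm,
    polarCoord_target, Measure.volume_eq_prod, ← Measure.prod_restrict, lintegral_prod]
  swap
  · apply Measurable.aemeasurable
    have : Measurable fun p : ℝ × ℝ => Complex.polarCoord.symm p := by
      simp only [Complex.polarCoord_symm_apply]; fun_prop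
    exact (ENNReal.measurable_ofReal.comp measurable_fst).smul (hFm.comp this)
  have step : ∀ r ∈ Set.Ioi (0 : ℝ), ∫⁻ θ in Set.Ioo (-Real.pi) Real.pi,
      ENNReal.ofReal r • (ball (0 : ℂ) 1).indicator F (Complex.polarCoord.symm (r, θ)) =
      (Set.Iio (1 : ℝ)).indicator (fun r => ∑' n : ℕ,
        ENNReal.ofReal (2 * Real.pi * ‖a n‖ ^ 2 * (r * (1 - r ^ 2) * r ^ (2 * n)))) r := by
    intro r hr
    have hr0 : 0 < r := hr
    have e : ∀ θ : ℝ, Complex.polarCoord.symm (r, θ) =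
        (r : ℂ) * Complex.exp (θ * Complex.I) := fun θ => by
      simp [Complex.exp_mul_I]
    have hn : ∀ θ : ℝ, ‖(r : ℂ) * Complex.exp (θ * Complex.I)‖ = r := fun θ => by
      simp [Complex.norm_exp_ofReal_mul_I, abs_of_pos hr0]
    simp only [e]
    by_cases h1 : r < 1
    · have hw : 0 ≤ 1 - r ^ 2 := by nlinarith
      rw [Set.indicator_of_mem (show r ∈ Set.Iio (1 : ℝ) from h1)]
      have : ∀ θ : ℝ, ENNReal.ofReal r •
          (ball (0 : ℂ) 1).indicator F ((r : ℂ) * Complex.exp (θ * Complex.I)) =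
          ENNReal.ofReal (r * (1 - r ^ 2)) *
            ENNReal.ofReal (‖h ((r : ℂ) * Complex.exp (θ * Complex.I))‖ ^ 2) := by
        intro θ
        rw [Set.indicator_of_mem (by rw [mem_ball_zero_iff, hn]; exact h1), hF]
        simp only [hn, smul_eq_mul]
        rw [← ENNReal.ofReal_mul hr0.le, ← ENNReal.ofReal_mul (by positivity)]
        congr 1; ring
      simp only [this]
      rw [lintegral_const_mul' _ _ ENNReal.ofReal_ne_top, lintegral_circle_norm_sq hc ha hr0.le h1,
        ← ENNReal.tsum_mul_left]
      refine tsum_congr fun n => ?_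
      rw [← ENNReal.ofReal_mul (by positivity)]
      congr 1; ring
    · rw [Set.indicator_of_notMem (by simpa using h1)]
      have : ∀ θ : ℝ, (ball (0 : ℂ) 1).indicator F ((r : ℂ) * Complex.exp (θ * Complex.I)) = 0 :=
        fun θ => Set.indicator_of_notMem (by rw [mem_ball_zero_iff, hn]; exact h1) _
      simp [this]
  rw [setLIntegral_congr_fun measurableSet_Ioi step, lintegral_indicator measurableSet_Iio,
    Measure.restrict_restrict measurableSet_Iio, lintegral_tsum (fun n => by fun_prop)]
  refine tsum_congr fun n => ?_
  have hset : Set.Iio (1 : ℝ) ∩ Set.Ioi 0 = Set.Ioo 0 1 := by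
    rw [Set.inter_comm]; rfl
  rw [hset, ← ofReal_integral_eq_lintegral_ofReal, integral_const_mul, ← integral_Ioc_eq_integral_Ioo,
    ← intervalIntegral.integral_of_le zero_le_one, integral_pow_mul_one_sub_sq]
  · congr 1
    field_simp
  · refine (Continuous.integrableOn_Icc (by fun_prop)).mono_set Set.Ioo_subset_Icc_self
  · refine (ae_restrict_iff' measurableSet_Ioo).2 (Filter.Eventually.of_forall fun r hr => ?_)
    have h0 := hr.1
    have : 0 ≤ 1 - r ^ 2 := by nlinarith [hr.1, hr.2]
    simp only [Pi.zero_apply]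
    positivity

end Parseval

/-! ### The analytic embedding of a bounded symbol -/

section Embedding
variable {H : Type*} [NormedAddCommGroup H] [InnerProductSpace ℂ H] [CompleteSpace H]

theorem lintegral_norm_diffOp_sq_le {h : ℂ → H} (hh : AnalyticOnNhd ℂ h (ball 0 1)) :
    ∫⁻ z in ball (0 : ℂ) 1, ENNReal.ofReal (‖diffOp h z‖ ^ 2 * (1 - ‖z‖ ^ 2)) ≤
      ENNReal.ofReal Real.pi * hardyNormSq h := by
  have hc : ContinuousOn (diffOp h) (ball 0 1) :=
    (continuousOn_id.smul hh.deriv.continuousOn).add hh.continuousOn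
  rw [lintegral_disc_norm_sq hc fun z hz => hasSum_diffOp hh hz, hardyNormSq, ← ENNReal.tsum_mul_left]
  refine ENNReal.tsum_le_tsum fun n => ?_
  rw [← ofReal_norm, ← ENNReal.ofReal_pow (norm_nonneg _),
    ← ENNReal.ofReal_mul Real.pi_pos.le]
  refine ENNReal.ofReal_le_ofReal ?_
  have e : ‖(n + 1 : ℂ)‖ = n + 1 := by
    rw [← Nat.cast_succ, Complex.norm_natCast, Nat.cast_succ]
  rw [norm_smul, e]
  have : Real.pi / ((n + 1) * (n + 2)) * ((n + 1) * ‖taylorCoeff h n‖) ^ 2 =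
      Real.pi * ‖taylorCoeff h n‖ ^ 2 * ((n + 1) / (n + 2)) := by
    field_simp
  rw [this]
  exact mul_le_of_le_one_right (by positivity) ((div_le_one (by positivity)).2 (by linarith))

theorem lintegral_norm_smul_deriv_sq_le {h : ℂ → H} (hh : AnalyticOnNhd ℂ h (ball 0 1)) :
    ∫⁻ z in ball (0 : ℂ) 1, ENNReal.ofReal (‖z • deriv h z‖ ^ 2 * (1 - ‖z‖ ^ 2)) ≤
      ENNReal.ofReal Real.pi * hardyNormSq h := by
  have hc : ContinuousOn (fun z => z • deriv h z) (ball 0 1) :=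
    continuousOn_id.smul hh.deriv.continuousOn
  rw [lintegral_disc_norm_sq hc fun z hz => hasSum_smul_deriv hh hz, hardyNormSq,
    ← ENNReal.tsum_mul_left]
  refine ENNReal.tsum_le_tsum fun n => ?_
  rw [← ofReal_norm, ← ENNReal.ofReal_pow (norm_nonneg _),
    ← ENNReal.ofReal_mul Real.pi_pos.le]
  refine ENNReal.ofReal_le_ofReal ?_
  rw [norm_smul, Complex.norm_natCast]
  have : Real.pi / ((n + 1) * (n + 2)) * (n * ‖taylorCoeff h n‖) ^ 2 =
      Real.pi * ‖taylorCoeff h n‖ ^ 2 * (n ^ 2 / ((n + 1) * (n + 2))) := by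
    field_simp
  rw [this]
  exact mul_le_of_le_one_right (by positivity) ((div_le_one (by positivity)).2 (by nlinarith))

/-- A bounded analytic operator-valued function is a bounded multiplier of `H²`. -/
theorem hardyNormSq_clm_apply_le {φ : ℂ → H →L[ℂ] H} {C : ℝ} (hφ : AnalyticOnNhd ℂ φ (ball 0 1))
    (hC : ∀ z ∈ ball (0 : ℂ) 1, ‖φ z‖ ≤ C) {f : ℂ → H} (hf : AnalyticOnNhd ℂ f (ball 0 1)) :
    hardyNormSq (fun z => φ z (f z)) ≤ ENNReal.ofReal (C ^ 2) * hardyNormSq f := by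
  have hg : AnalyticOnNhd ℂ (fun z => φ z (f z)) (ball 0 1) :=
    (hφ.differentiableOn.clm_apply hf.differentiableOn).analyticOnNhd isOpen_ball
  have hp : 0 < 2 * Real.pi := by positivity
  have circle : ∀ {g : ℂ → H}, AnalyticOnNhd ℂ g (ball 0 1) → ∀ r : ℝ, 0 ≤ r → r < 1 →
      ∫⁻ θ in Set.Ioo (-Real.pi) Real.pi,
        ENNReal.ofReal (‖g ((r : ℂ) * Complex.exp (θ * Complex.I))‖ ^ 2) =
      ENNReal.ofReal (2 * Real.pi) *
        ∑' n : ℕ, ENNReal.ofReal (r ^ (2 * n)) * ‖taylorCoeff g n‖ₑ ^ 2 := by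
    intro g hg r hr0 hr
    rw [lintegral_circle_norm_sq hg.continuousOn (fun z hz => hasSum_taylorCoeff hg hz) hr0 hr,
      ← ENNReal.tsum_mul_left]
    refine tsum_congr fun n => ?_
    rw [ENNReal.ofReal_mul hp.le, ENNReal.ofReal_mul (p := r ^ (2 * n)) (by positivity),
      ENNReal.ofReal_pow (norm_nonneg _), ofReal_norm]
  -- The estimate for the dilations `z ↦ φ (r z) f (r z)`; the claim follows as `r` tends to `1`.
  have dil : ∀ r : ℝ, 0 ≤ r → r < 1 →
      ∑' n : ℕ, ENNReal.ofReal (r ^ (2 * n)) * ‖taylorCoeff (fun z => φ z (f z)) n‖ₑ ^ 2 ≤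
        ENNReal.ofReal (C ^ 2) * hardyNormSq f := by
    intro r hr0 hr
    rw [← ENNReal.mul_le_mul_iff_right (a := ENNReal.ofReal (2 * Real.pi))
      (by simpa using Real.pi_pos) ENNReal.ofReal_ne_top, ← circle hg r hr0 hr]
    calc _ ≤ ∫⁻ θ in Set.Ioo (-Real.pi) Real.pi, ENNReal.ofReal (C ^ 2) *
          ENNReal.ofReal (‖f ((r : ℂ) * Complex.exp (θ * Complex.I))‖ ^ 2) := by
          refine lintegral_mono fun θ => ?_
          rw [← ENNReal.ofReal_mul (by positivity), ← mul_pow]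
          refine ENNReal.ofReal_le_ofReal ?_
          gcongr
          refine (ContinuousLinearMap.le_opNorm _ _).trans ?_
          gcongr
          refine hC _ ?_
          rw [mem_ball_zero_iff]
          simpa [Complex.norm_exp_ofReal_mul_I, abs_of_nonneg hr0] using hr
      _ ≤ _ := by
          rw [lintegral_const_mul' _ _ ENNReal.ofReal_ne_top, circle hf r hr0 hr, mul_left_comm,
            hardyNormSq]
          gcongr with n
          refine mul_le_of_le_one_left (by positivity) ?_
          rw [ENNReal.ofReal_le_one]
          exact pow_le_one₀ hr0 hr.le
  refine ENNReal.tsum_le_of_sum_range_le fun N => ?_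
  have lim : Filter.Tendsto (fun r : ℝ => ∑ n ∈ Finset.range N, ENNReal.ofReal (r ^ (2 * n)) *
      ‖taylorCoeff (fun z => φ z (f z)) n‖ₑ ^ 2) (nhdsWithin 1 (Set.Iio 1))
      (nhds (∑ n ∈ Finset.range N, ‖taylorCoeff (fun z => φ z (f z)) n‖ₑ ^ 2)) := by
    refine tendsto_finsetSum _ fun n _ => ?_
    have h1 : Filter.Tendsto (fun r : ℝ => ENNReal.ofReal (r ^ (2 * n)))
        (nhdsWithin 1 (Set.Iio 1)) (nhds 1) := by
      have : Continuous fun r : ℝ => ENNReal.ofReal (r ^ (2 * n)) :=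
        ENNReal.continuous_ofReal.comp (by fun_prop)
      simpa using (this.tendsto 1).mono_left nhdsWithin_le_nhds
    simpa using ENNReal.Tendsto.mul_const h1 (Or.inr (by simp))
  refine le_of_tendsto lim ?_
  filter_upwards [Ioo_mem_nhdsLT (zero_lt_one (α := ℝ))] with r hr
  exact (ENNReal.sum_le_tsum _).trans (dil r hr.1.le hr.2)

/-- Every bounded analytic symbol gives a bounded analytic embedding: by the product rule
`(Dφ) f = D(φ f) - z φ f'`, and both terms are controlled by Parseval's identity. -/
theorem analyticCarleson_le {φ : ℂ → H →L[ℂ] H} {C : ℝ} (hφ : AnalyticOnNhd ℂ φ (ball 0 1))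
    (hC : ∀ z ∈ ball (0 : ℂ) 1, ‖φ z‖ ≤ C) :
    analyticCarleson φ ≤ ENNReal.ofReal (4 * Real.pi * C ^ 2) := by
  refine iSup₂_le fun f hf => ?_
  obtain ⟨⟨R, hR, hfR⟩, hf1⟩ := hf
  have hf : AnalyticOnNhd ℂ f (ball 0 1) := hfR.mono (ball_subset_ball hR.le)
  have hg : AnalyticOnNhd ℂ (fun z => φ z (f z)) (ball 0 1) :=
    (hφ.differentiableOn.clm_apply hf.differentiableOn).analyticOnNhd isOpen_ball
  have hprod : ∀ z ∈ ball (0 : ℂ) 1,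
      diffOp φ z (f z) = diffOp (fun z => φ z (f z)) z - φ z (z • deriv f z) := by
    intro z hz
    have h := (hφ z hz).differentiableAt.hasDerivAt.clm_apply (hf z hz).differentiableAt.hasDerivAt
    simp only [diffOp, h.deriv]
    simp
    abel
  calc _ ≤ ∫⁻ z in ball (0 : ℂ) 1,
        (2 * ENNReal.ofReal (‖diffOp (fun z => φ z (f z)) z‖ ^ 2 * (1 - ‖z‖ ^ 2)) +
          2 * (ENNReal.ofReal (C ^ 2) * ENNReal.ofReal (‖z • deriv f z‖ ^ 2 * (1 - ‖z‖ ^ 2)))) := by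
        refine setLIntegral_mono' measurableSet_ball fun z hz => ?_
        have hw : 0 ≤ 1 - ‖z‖ ^ 2 := by
          have := mem_ball_zero_iff.1 hz
          nlinarith [norm_nonneg z]
        rw [← ENNReal.ofReal_ofNat 2, ← ENNReal.ofReal_mul (by positivity),
          ← ENNReal.ofReal_mul (by positivity), ← ENNReal.ofReal_mul (by positivity),
          ← ENNReal.ofReal_add (by positivity) (by positivity)]
        refine ENNReal.ofReal_le_ofReal ?_
        rw [hprod z hz]
        have h1 := norm_sub_le (diffOp (fun z => φ z (f z)) z) (φ z (z • deriv f z))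
        have h2 : ‖φ z (z • deriv f z)‖ ≤ C * ‖z • deriv f z‖ :=
          ((φ z).le_opNorm _).trans (by gcongr; exact hC z hz)
        set x := ‖diffOp (fun z => φ z (f z)) z‖
        set y := C * ‖z • deriv f z‖ with hy
        have h3 : ‖diffOp (fun z => φ z (f z)) z - φ z (z • deriv f z)‖ ^ 2 ≤ (x + y) ^ 2 := by
          gcongr
          linarith
        have h4 : (x + y) ^ 2 ≤ 2 * x ^ 2 + 2 * y ^ 2 := by nlinarith [sq_nonneg (x - y)]
        calc _ ≤ (2 * x ^ 2 + 2 * y ^ 2) * (1 - ‖z‖ ^ 2) := by gcongr; linarith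
          _ = _ := by rw [hy]; ring
    _ = 2 * (∫⁻ z in ball (0 : ℂ) 1,
          ENNReal.ofReal (‖diffOp (fun z => φ z (f z)) z‖ ^ 2 * (1 - ‖z‖ ^ 2))) +
        2 * (ENNReal.ofReal (C ^ 2) * ∫⁻ z in ball (0 : ℂ) 1,
          ENNReal.ofReal (‖z • deriv f z‖ ^ 2 * (1 - ‖z‖ ^ 2))) := by
        rw [lintegral_add_left' ?_, lintegral_const_mul' _ _ (by simp),
          lintegral_const_mul' _ _ (by simp), lintegral_const_mul' _ _ (by simp)]
        have hc : ContinuousOn (diffOp fun z => φ z (f z)) (ball 0 1) :=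
          (continuousOn_id.smul hg.deriv.continuousOn).add hg.continuousOn
        refine AEMeasurable.const_mul ?_ _
        refine ContinuousOn.aemeasurable ?_ measurableSet_ball
        exact ENNReal.continuous_ofReal.comp_continuousOn ((hc.norm.pow 2).mul (by fun_prop))
    _ ≤ 2 * (ENNReal.ofReal Real.pi * ENNReal.ofReal (C ^ 2)) +
        2 * (ENNReal.ofReal (C ^ 2) * ENNReal.ofReal Real.pi) := by
        have h1 := hardyNormSq_clm_apply_le hφ hC hf
        rw [hf1, mul_one] at h1
        have h2 := lintegral_norm_smul_deriv_sq_le hf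
        rw [hf1, mul_one] at h2
        exact add_le_add
          (mul_le_mul_right ((lintegral_norm_diffOp_sq_le hg).trans (mul_le_mul_right h1 _)) _)
          (mul_le_mul_right (mul_le_mul_right h2 _) _)
    _ = _ := by
        rw [← ENNReal.ofReal_ofNat 2, ← ENNReal.ofReal_mul (by positivity),
          ← ENNReal.ofReal_mul (by positivity), ← ENNReal.ofReal_mul (by positivity),
          ← ENNReal.ofReal_mul (by positivity), ← ENNReal.ofReal_add (by positivity) (by positivity)]
        congr 1; ring

end Embedding

/-! ### The Hilbert matrix along an orthonormal sequence -/

section Hilbert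

/-- Any orthonormal family can be mapped to any other one by a bounded operator. Both families embed
`ℓ²` isometrically; the operator is the second embedding after the adjoint of the first. -/
theorem exists_clm_apply_orthonormal {ι E F : Type*} [NormedAddCommGroup E]
    [InnerProductSpace ℂ E] [CompleteSpace E] [NormedAddCommGroup F] [InnerProductSpace ℂ F]
    [CompleteSpace F] {e : ι → E} {e' : ι → F} (he : Orthonormal ℂ e) (he' : Orthonormal ℂ e') :
    ∃ S : E →L[ℂ] F, ∀ i, S (e i) = e' i := by
  classical
  let W := he.orthogonalFamily.linearIsometry
  let V := he'.orthogonalFamily.linearIsometry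
  have hW : ∀ i, W (lp.single 2 i (1 : ℂ)) = e i := fun i => by
    simp [W, OrthogonalFamily.linearIsometry_apply_single]
  have hV : ∀ i, V (lp.single 2 i (1 : ℂ)) = e' i := fun i => by
    simp [V, OrthogonalFamily.linearIsometry_apply_single]
  refine ⟨V.toContinuousLinearMap ∘L (ContinuousLinearMap.adjoint W.toContinuousLinearMap),
    fun i => ?_⟩
  rw [← hW, ← hV]
  have : (ContinuousLinearMap.adjoint W.toContinuousLinearMap)
      (W.toContinuousLinearMap (lp.single 2 i (1 : ℂ))) = lp.single 2 i (1 : ℂ) := by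
    refine ext_inner_left ℂ fun v => ?_
    rw [ContinuousLinearMap.adjoint_inner_right]
    exact W.inner_map_map _ _
  simpa using congrArg V this

/-- The sawtooth `x - 1 / 2` on `[0, 1)`, as a bounded function on the circle. -/
theorem memLp_periodizedBernoulli_one :
    MemLp (fun x => (periodizedBernoulli 1 x : ℂ)) ∞ (@AddCircle.haarAddCircle (1 : ℝ) _) := by
  have hm : Measurable (periodizedBernoulli 1) := by
    have : Measurable (bernoulliFun 1) := (Polynomial.continuous _).measurable
    exact (this.comp measurable_subtype_coe).comp (AddCircle.measurableEquivIco 1 0).measurable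
  refine memLp_top_of_bound (C := 1) (Complex.measurable_ofReal.comp hm).aestronglyMeasurable
    (Filter.Eventually.of_forall fun x => ?_)
  have hx := (AddCircle.equivIco (1 : ℝ) 0 x).2
  have : periodizedBernoulli 1 x = (AddCircle.equivIco (1 : ℝ) 0 x : ℝ) - 1 / 2 :=
    bernoulliFun_one _
  rw [this, Complex.norm_real, Real.norm_eq_abs, abs_le]
  constructor <;> linarith [hx.1, hx.2]

/-- The Hilbert matrix acts boundedly along any orthonormal sequence: it is the Toeplitz matrix of
the bounded sawtooth function on the circle. -/
theorem exists_hilbert_matrix {H : Type*} [NormedAddCommGroup H] [InnerProductSpace ℂ H]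
    [CompleteSpace H] {e : ℕ → H} (he : Orthonormal ℂ e) :
    ∃ T : H →L[ℂ] H, ∀ i j : ℕ, inner ℂ (e i) (T (e j)) = (((i : ℝ) - j)⁻¹ : ℝ) := by
  let μ := @AddCircle.haarAddCircle (1 : ℝ) _
  have ho : Orthonormal ℂ fun n : ℕ => @fourierLp 1 _ 2 _ (n : ℤ) :=
    orthonormal_fourier.comp _ Nat.cast_injective
  obtain ⟨S, hS⟩ := exists_clm_apply_orthonormal he ho
  let g := memLp_periodizedBernoulli_one.toLp
  let M := (ContinuousLinearMap.mul ℂ ℂ).holderL μ ∞ 2 2 g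
  -- The Toeplitz matrix of the sawtooth has entries `-1 / (2 π i (i - j))`; on the diagonal, `0⁻¹ = 0`
  -- agrees with the vanishing mean of the sawtooth.
  refine ⟨(-(2 * Real.pi * Complex.I)) • (ContinuousLinearMap.adjoint S ∘L M ∘L S), fun i j => ?_⟩
  simp only [_root_.smul_apply, ContinuousLinearMap.comp_apply, inner_smul_right,
    ContinuousLinearMap.adjoint_inner_right, hS]
  have key : inner ℂ (@fourierLp 1 _ 2 _ (i : ℤ)) (M (@fourierLp 1 _ 2 _ (j : ℤ))) =
      fourierCoeff ((↑) ∘ periodizedBernoulli 1 : UnitAddCircle → ℂ) ((i : ℤ) - j) := by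
    rw [L2.inner_def, fourierCoeff]
    refine integral_congr_ae ?_
    filter_upwards [(ContinuousLinearMap.mul ℂ ℂ).coeFn_holder (r := 2) g
      (@fourierLp 1 _ 2 _ (j : ℤ)), memLp_periodizedBernoulli_one.coeFn_toLp,
      coeFn_fourierLp 2 (i : ℤ), coeFn_fourierLp 2 (j : ℤ)] with x h1 h2 h3 h4
    have h1' : M (@fourierLp 1 _ 2 _ (j : ℤ)) x = _ := h1
    rw [h1', h2, h3, h4]
    simp only [RCLike.inner_apply, ContinuousLinearMap.mul_apply', smul_eq_mul, neg_sub,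
      Function.comp_apply, sub_eq_add_neg (j : ℤ), fourier_add, fourier_neg]
    ring
  rw [key, fourierCoeff_bernoulli_eq one_ne_zero]
  have hπ : (Real.pi : ℂ) ≠ 0 := by exact_mod_cast Real.pi_ne_zero
  push_cast
  by_cases h : (i : ℂ) - j = 0
  · simp [h]
  · field_simp
    simp

end Hilbert

/-! ### The lacunary diagonal operators -/

section Diagonal
variable {H : Type*} [NormedAddCommGroup H] [InnerProductSpace ℂ H]

theorem norm_sum_smul_sq {ι : Type*} {e : ι → H} (he : Orthonormal ℂ e) (c : ι → ℂ)
    (s : Finset ι) : ‖∑ i ∈ s, c i • e i‖ ^ 2 = ∑ i ∈ s, ‖c i‖ ^ 2 := by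
  have h := he.inner_sum c c s
  rw [inner_self_eq_norm_sq_to_K] at h
  apply Complex.ofReal_injective
  push_cast
  refine h.trans (Finset.sum_congr rfl fun i _ => ?_)
  rw [mul_comm, Complex.mul_conj, Complex.normSq_eq_norm_sq]
  push_cast
  rfl

/-- The diagonal operator `e i ↦ z ^ 2 ^ i • e i` along a sequence `e`, zero on the orthogonal
complement. The series converges in operator norm for `|z| < 1`; only these `z` matter. -/
noncomputable def lacunaryDiag (e : ℕ → H) (z : ℂ) : H →L[ℂ] H :=
  ∑' i : ℕ, z ^ 2 ^ i • InnerProductSpace.rankOne ℂ (e i) (e i)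

variable [CompleteSpace H] {e : ℕ → H}

theorem norm_pow_two_pow_smul_rankOne_le (he : Orthonormal ℂ e) {r : ℝ} (hr : r < 1) {z : ℂ}
    (hz : ‖z‖ ≤ r) (i : ℕ) :
    ‖z ^ 2 ^ i • InnerProductSpace.rankOne ℂ (e i) (e i)‖ ≤ r ^ i := by
  have hr0 := (norm_nonneg z).trans hz
  rw [norm_smul, norm_pow, InnerProductSpace.norm_rankOne, he.1]
  calc ‖z‖ ^ 2 ^ i * (1 * 1) ≤ r ^ 2 ^ i := by rw [one_mul, mul_one]; gcongr
    _ ≤ r ^ i := pow_le_pow_of_le_one hr0 hr.le Nat.lt_two_pow_self.le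

theorem hasSum_lacunaryDiag (he : Orthonormal ℂ e) {z : ℂ} (hz : z ∈ ball (0 : ℂ) 1) :
    HasSum (fun i : ℕ => z ^ 2 ^ i • InnerProductSpace.rankOne ℂ (e i) (e i))
      (lacunaryDiag e z) := by
  have hz' := mem_ball_zero_iff.1 hz
  exact (Summable.of_norm_bounded (summable_geometric_of_lt_one (norm_nonneg z) hz')
    (norm_pow_two_pow_smul_rankOne_le he hz' le_rfl)).hasSum

theorem analyticOnNhd_lacunaryDiag (he : Orthonormal ℂ e) :
    AnalyticOnNhd ℂ (lacunaryDiag e) (ball 0 1) := by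
  refine DifferentiableOn.analyticOnNhd (fun z hz => ?_) isOpen_ball
  obtain ⟨r, hzr, hr⟩ := exists_between (mem_ball_zero_iff.1 hz)
  have hr0 := (norm_nonneg z).trans hzr.le
  have : DifferentiableOn ℂ (lacunaryDiag e) (ball 0 r) :=
    Complex.differentiableOn_tsum_of_summable_norm (summable_geometric_of_lt_one hr0 hr)
      (fun i => by fun_prop) isOpen_ball
      fun i w hw => norm_pow_two_pow_smul_rankOne_le he hr (mem_ball_zero_iff.1 hw).le i
  exact ((this z (by simpa using hzr)).differentiableAt
    (isOpen_ball.mem_nhds (by simpa using hzr))).differentiableWithinAt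

theorem hasSum_lacunaryDiag_apply (he : Orthonormal ℂ e) {z : ℂ} (hz : z ∈ ball (0 : ℂ) 1)
    (v : H) :
    HasSum (fun i : ℕ => (z ^ 2 ^ i * inner ℂ (e i) v) • e i) (lacunaryDiag e z v) := by
  have := (ContinuousLinearMap.apply ℂ H v).hasSum (hasSum_lacunaryDiag he hz)
  simpa [Function.comp_def, smul_smul] using this

theorem lacunaryDiag_apply_self (he : Orthonormal ℂ e) {z : ℂ} (hz : z ∈ ball (0 : ℂ) 1)
    (j : ℕ) : lacunaryDiag e z (e j) = z ^ 2 ^ j • e j := by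
  refine (hasSum_lacunaryDiag_apply he hz (e j)).unique ?_
  have h := hasSum_single (f := fun i : ℕ => (z ^ 2 ^ i * inner ℂ (e i) (e j)) • e i) j
    fun i hi => by simp [he.2 hi]
  simpa [inner_self_eq_norm_sq_to_K, he.1] using h

theorem inner_lacunaryDiag_apply (he : Orthonormal ℂ e) {z : ℂ} (hz : z ∈ ball (0 : ℂ) 1)
    (i : ℕ) (v : H) : inner ℂ (e i) (lacunaryDiag e z v) = z ^ 2 ^ i * inner ℂ (e i) v := by
  refine ((innerSL ℂ (e i)).hasSum (hasSum_lacunaryDiag_apply he hz v)).unique ?_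
  have h := hasSum_single
    (f := fun j : ℕ => inner ℂ (e i) ((z ^ 2 ^ j * inner ℂ (e j) v) • e j)) i
    fun j hj => by simp [he.2 hj.symm]
  simpa [inner_smul_right, inner_self_eq_norm_sq_to_K, he.1, Function.comp_def] using h

theorem norm_lacunaryDiag_le (he : Orthonormal ℂ e) {z : ℂ} (hz : z ∈ ball (0 : ℂ) 1) :
    ‖lacunaryDiag e z‖ ≤ 1 := by
  refine ContinuousLinearMap.opNorm_le_bound _ zero_le_one fun v => ?_
  rw [one_mul]
  refine le_of_tendsto (hasSum_lacunaryDiag_apply he hz v).norm (Filter.Eventually.of_forall fun s => ?_)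
  refine (sq_le_sq₀ (norm_nonneg _) (norm_nonneg v)).1 ?_
  rw [norm_sum_smul_sq he]
  refine le_trans (Finset.sum_le_sum fun i _ => ?_) (he.sum_inner_products_le v (s := s))
  rw [norm_mul, norm_pow]
  gcongr
  exact mul_le_of_le_one_left (norm_nonneg _) (pow_le_one₀ (norm_nonneg z) (mem_ball_zero_iff.1 hz).le)

end Diagonal

/-! ### The symbol -/

section Symbol
variable {H : Type*} [NormedAddCommGroup H] [InnerProductSpace ℂ H]

theorem exists_orthonormal_nat [CompleteSpace H] (hH : ¬ FiniteDimensional ℂ H) :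
    ∃ e : ℕ → H, Orthonormal ℂ e := by
  obtain ⟨w, b, -⟩ := exists_hilbertBasis ℂ H
  cases finite_or_infinite w with
  | inl h =>
    have := Fintype.ofFinite w
    exact absurd b.toOrthonormalBasis.toBasis.finiteDimensional_of_finite hH
  | inr h => exact ⟨_, b.orthonormal.comp _ (Infinite.natEmbedding w).injective⟩

/-- The symbol `φ(z) = D(z) T D(z)`, where `D(z)` is the lacunary diagonal operator. -/
noncomputable def lacunarySymbol (e : ℕ → H) (T : H →L[ℂ] H) (z : ℂ) : H →L[ℂ] H :=
  lacunaryDiag e z ∘L T ∘L lacunaryDiag e z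

variable [CompleteSpace H] {e : ℕ → H}

theorem analyticOnNhd_lacunarySymbol (he : Orthonormal ℂ e) (T : H →L[ℂ] H) :
    AnalyticOnNhd ℂ (lacunarySymbol e T) (ball 0 1) := by
  have h := (analyticOnNhd_lacunaryDiag he).differentiableOn
  exact (h.clm_comp ((differentiableOn_const T).clm_comp h)).analyticOnNhd isOpen_ball

theorem norm_lacunarySymbol_le (he : Orthonormal ℂ e) (T : H →L[ℂ] H) {z : ℂ}
    (hz : z ∈ ball (0 : ℂ) 1) : ‖lacunarySymbol e T z‖ ≤ ‖T‖ := by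
  have h := norm_lacunaryDiag_le he hz
  calc ‖lacunarySymbol e T z‖ ≤ ‖lacunaryDiag e z‖ * (‖T‖ * ‖lacunaryDiag e z‖) :=
        (ContinuousLinearMap.opNorm_comp_le _ _).trans
          (by gcongr; exact ContinuousLinearMap.opNorm_comp_le _ _)
    _ ≤ 1 * (‖T‖ * 1) := by gcongr
    _ = ‖T‖ := by ring

theorem inner_lacunarySymbol_apply_sum (he : Orthonormal ℂ e) (T : H →L[ℂ] H) {z : ℂ}
    (hz : z ∈ ball (0 : ℂ) 1) (s : Finset ℕ) (c : ℕ → ℂ) (i : ℕ) :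
    inner ℂ (e i) (lacunarySymbol e T z (∑ j ∈ s, c j • e j)) =
      ∑ j ∈ s, c j * inner ℂ (e i) (T (e j)) * z ^ (2 ^ i + 2 ^ j) := by
  simp only [lacunarySymbol, ContinuousLinearMap.comp_apply, inner_lacunaryDiag_apply he hz,
    map_sum, map_smul, lacunaryDiag_apply_self he hz, inner_sum, inner_smul_right]
  refine Finset.sum_congr rfl fun j _ => ?_
  ring

theorem inner_diffOp_lacunarySymbol_apply_sum (he : Orthonormal ℂ e) (T : H →L[ℂ] H) {z : ℂ}
    (hz : z ∈ ball (0 : ℂ) 1) (s : Finset ℕ) (c : ℕ → ℂ) (i : ℕ) :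
    inner ℂ (e i) (diffOp (lacunarySymbol e T) z (∑ j ∈ s, c j • e j)) =
      ∑ j ∈ s, c j * inner ℂ (e i) (T (e j)) * ((2 ^ i + 2 ^ j + 1) * z ^ (2 ^ i + 2 ^ j)) := by
  set v := ∑ j ∈ s, c j • e j with hv
  -- Differentiation commutes with the functional `A ↦ ⟪e i, A v⟫`, which turns `φ` into a polynomial.
  let Λ : (H →L[ℂ] H) →L[ℂ] ℂ := (innerSL ℂ (e i)) ∘L (ContinuousLinearMap.apply ℂ H v)
  have hd := ((analyticOnNhd_lacunarySymbol he T) z hz).differentiableAt.hasDerivAt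
  have h1 : HasDerivAt (fun w => Λ (lacunarySymbol e T w)) (Λ (deriv (lacunarySymbol e T) z)) z :=
    Λ.hasFDerivAt.comp_hasDerivAt z hd
  have h2 : HasDerivAt (fun w : ℂ => ∑ j ∈ s, c j * inner ℂ (e i) (T (e j)) * w ^ (2 ^ i + 2 ^ j))
      (∑ j ∈ s, c j * inner ℂ (e i) (T (e j)) *
        ((2 ^ i + 2 ^ j : ℕ) * z ^ (2 ^ i + 2 ^ j - 1))) z :=
    HasDerivAt.fun_sum fun j _ => (hasDerivAt_pow _ z).const_mul _
  have h3 : (fun w => Λ (lacunarySymbol e T w)) =ᶠ[nhds z]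
      fun w : ℂ => ∑ j ∈ s, c j * inner ℂ (e i) (T (e j)) * w ^ (2 ^ i + 2 ^ j) := by
    filter_upwards [isOpen_ball.mem_nhds hz] with w hw
    exact inner_lacunarySymbol_apply_sum he T hw s c i
  have h4 := h1.unique (h2.congr_of_eventuallyEq h3)
  have h5 : inner ℂ (e i) (deriv (lacunarySymbol e T) z v) = _ := h4
  simp only [diffOp, _root_.add_apply, _root_.smul_apply, inner_add_right, inner_smul_right]
  rw [h5, hv, inner_lacunarySymbol_apply_sum he T hz, Finset.mul_sum, ← Finset.sum_add_distrib]
  refine Finset.sum_congr rfl fun j _ => ?_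
  have hpos : 2 ^ i + 2 ^ j ≠ 0 := by positivity
  have : z ^ (2 ^ i + 2 ^ j) = z * z ^ (2 ^ i + 2 ^ j - 1) := (mul_pow_sub_one hpos z).symm
  rw [this]
  push_cast
  ring

end Symbol

/-! ### Lacunary test functions -/

section TestFunction
variable {H : Type*} [NormedAddCommGroup H] [InnerProductSpace ℂ H]

theorem taylorCoeff_sum_pow_smul {Y : Type*} [NormedAddCommGroup Y] [NormedSpace ℂ Y] {ι : Type*}
    (s : Finset ι) (k : ι → ℕ) (v : ι → Y) (n : ℕ) :
    taylorCoeff (fun z : ℂ => ∑ j ∈ s, z ^ k j • v j) n = ∑ j ∈ s, if k j = n then v j else 0 := by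
  have hp : ∀ j, ContDiff ℂ n fun z : ℂ => z ^ k j := fun j => by fun_prop
  have hv : ∀ j ∈ s, ContDiffAt ℂ n (fun z : ℂ => z ^ k j • v j) 0 := fun j _ =>
    ((hp j).smul contDiff_const).contDiffAt
  rw [taylorCoeff, iteratedDeriv_fun_sum hv, Finset.smul_sum]
  refine Finset.sum_congr rfl fun j _ => ?_
  rw [iteratedDeriv_smul_const (hp j).contDiffAt, iteratedDeriv_fun_pow_zero]
  split_ifs with h1 h2 h2
  · subst h1
    rw [smul_smul, inv_mul_cancel₀ (by exact_mod_cast Nat.factorial_ne_zero _), one_smul]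
  all_goals first | omega | simp

theorem hardyNormSq_lacunary {Y : Type*} [NormedAddCommGroup Y] [NormedSpace ℂ Y] (M : ℕ)
    (v : ℕ → Y) :
    hardyNormSq (fun z : ℂ => ∑ j ∈ Finset.range M, z ^ 2 ^ j • v j) =
      ∑ j ∈ Finset.range M, ‖v j‖ₑ ^ 2 := by
  have hinj : Function.Injective fun j : ℕ => 2 ^ j := Nat.pow_right_injective le_rfl
  simp only [hardyNormSq, taylorCoeff_sum_pow_smul]
  rw [← hinj.tsum_eq]
  · rw [tsum_eq_sum (s := Finset.range M)]
    · refine Finset.sum_congr rfl fun j hj => ?_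
      simp only [hinj.eq_iff, Finset.sum_ite_eq', hj, if_true]
    · intro j hj
      simp only [hinj.eq_iff, Finset.sum_ite_eq', hj, if_false]
      simp
  · intro n hn
    by_contra h
    apply hn
    have : ∀ j, 2 ^ j ≠ n := fun j hj => h ⟨j, hj⟩
    simp [this]

theorem sum_lacunary_mem_normalizedAnalytic [CompleteSpace H] {e : ℕ → H} (he : Orthonormal ℂ e) {M : ℕ}
    (hM : M ≠ 0) :
    (fun z : ℂ => ∑ j ∈ Finset.range M, z ^ 2 ^ j • (((√(M : ℝ))⁻¹ : ℝ) : ℂ) • e j) ∈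
      normalizedAnalytic H := by
  refine ⟨⟨2, one_lt_two, ?_⟩, ?_⟩
  · exact DifferentiableOn.analyticOnNhd (by fun_prop) isOpen_ball
  · rw [hardyNormSq_lacunary]
    have : ∀ j, ‖(((√(M : ℝ))⁻¹ : ℝ) : ℂ) • e j‖ₑ ^ 2 = ENNReal.ofReal ((M : ℝ)⁻¹) := fun j => by
      rw [← ofReal_norm, ← ENNReal.ofReal_pow (norm_nonneg _), norm_smul, he.1, mul_one,
        Complex.norm_real, Real.norm_eq_abs, sq_abs, inv_pow, Real.sq_sqrt (Nat.cast_nonneg M)]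
    simp only [this, Finset.sum_const, Finset.card_range, nsmul_eq_mul]
    rw [← ENNReal.ofReal_natCast, ← ENNReal.ofReal_mul (Nat.cast_nonneg M),
      mul_inv_cancel₀ (by exact_mod_cast hM), ENNReal.ofReal_one]

end TestFunction

/-! ### Truncated rows of the Hilbert matrix -/

section Rows

/-- The `i`-th coordinate of `(Dφ)(z) f(z̄)`, up to normalization and a factor of modulus
`|z| ^ 2 ^ i`, as a function of `s = |z|²`. -/
noncomputable def hilbertRow (M i : ℕ) (s : ℝ) : ℝ :=
  ∑ j ∈ Finset.range M, ((i : ℝ) - j)⁻¹ * ((2 ^ i + 2 ^ j + 1) * s ^ 2 ^ j)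

/-- The constant comes from `(1 - 2 / n) (1 + 4 / n) ≥ 1`, valid for `n ≥ 4`. -/
theorem exp_neg_four_le_pow {n : ℕ} (hn : 4 ≤ n) {s : ℝ} (hs : 1 - 2 / (n : ℝ) ≤ s) :
    Real.exp (-4) ≤ s ^ n := by
  have hn' : (4 : ℝ) ≤ n := by exact_mod_cast hn
  have hn0 : (0 : ℝ) < n := by linarith
  have h1 : Real.exp (-(4 / n)) ≤ s := by
    rw [Real.exp_neg]
    refine (inv_anti₀ (by positivity) ((add_comm _ _).trans_le (Real.add_one_le_exp (4 / (n : ℝ))))).trans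
      (le_trans ?_ hs)
    rw [inv_le_iff_one_le_mul₀ (by positivity)]
    have : (1 - 2 / (n : ℝ)) * (1 + 4 / n) = 1 + (2 * n - 8) / n ^ 2 := by
      field_simp; ring
    rw [this]
    have : 0 ≤ (2 * (n : ℝ) - 8) / n ^ 2 := div_nonneg (by linarith) (by positivity)
    linarith
  calc Real.exp (-4) = Real.exp (-(4 / n)) ^ n := by
        rw [← Real.exp_nat_mul]; congr 1; field_simp
    _ ≤ s ^ n := by gcongr

theorem sq_mul_exp_neg_le {x : ℝ} (hx : 0 ≤ x) : x ^ 2 * Real.exp (-x) ≤ 2 := by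
  rw [Real.exp_neg, ← div_eq_mul_inv, div_le_iff₀ (Real.exp_pos x)]
  nlinarith [Real.quadratic_le_exp_of_nonneg hx]

/-- For `s ≤ 1 - 2 ^ (-i)` the decay of `s ^ 2 ^ (i + d)`, at least as fast as `exp (-2 ^ d)`, beats the
growth of `2 ^ d`. -/
theorem pow_two_pow_add_le {i d : ℕ} {s : ℝ} (hs0 : 0 ≤ s) (hs : s ≤ 1 - 1 / 2 ^ i) :
    2 ^ d * s ^ 2 ^ (i + d) ≤ 2 * (1 / 2) ^ d := by
  have h1 : s ≤ Real.exp (-(1 / 2 ^ i)) := by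
    have := Real.add_one_le_exp (-(1 / 2 ^ i : ℝ))
    linarith
  have h2 : s ^ 2 ^ (i + d) ≤ Real.exp (-2 ^ d) := by
    calc s ^ 2 ^ (i + d) ≤ Real.exp (-(1 / 2 ^ i)) ^ 2 ^ (i + d) := by gcongr
      _ = Real.exp (-2 ^ d) := by
        rw [← Real.exp_nat_mul]; congr 1; push_cast; rw [pow_add]; field_simp
  have h3 := sq_mul_exp_neg_le (x := 2 ^ d) (by positivity)
  have hd : (0 : ℝ) < 2 ^ d := by positivity
  calc 2 ^ d * s ^ 2 ^ (i + d) ≤ 2 ^ d * Real.exp (-2 ^ d) := by gcongr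
    _ = ((2 ^ d) ^ 2 * Real.exp (-2 ^ d)) * (1 / 2) ^ d := by
      rw [div_pow, one_pow]; field_simp
    _ ≤ 2 * (1 / 2) ^ d := by gcongr

theorem sum_range_half_pow_succ_le (n : ℕ) : ∑ k ∈ Finset.range n, (1 / 2 : ℝ) ^ (k + 1) ≤ 1 := by
  have : ∑ k ∈ Finset.range n, (1 / 2 : ℝ) ^ (k + 1) = 1 - (1 / 2) ^ n := by
    induction n with
    | zero => simp
    | succ n ih => rw [Finset.sum_range_succ, ih]; ring
  rw [this]
  have : (0 : ℝ) < (1 / 2) ^ n := by positivity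
  linarith

/-- On the annulus where `1 - s` is comparable to `2 ^ (-i)`, the positive terms `j < i` of the row
contribute a harmonic sum, while the negative terms `j > i` are negligible. -/
theorem le_hilbertRow {M i : ℕ} (hi : 2 ≤ i) (hiM : i < M) {s : ℝ} (hs : 1 - 2 / 2 ^ i ≤ s)
    (hs' : s ≤ 1 - 1 / 2 ^ i) :
    2 ^ i * (Real.exp (-4) * ∑ k ∈ Finset.range i, 1 / ((k : ℝ) + 1) - 4) ≤ hilbertRow M i s := by
  have h4 : 4 ≤ 2 ^ i := by
    calc 4 = 2 ^ 2 := rfl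
      _ ≤ 2 ^ i := Nat.pow_le_pow_right two_pos hi
  have h4' : (4 : ℝ) ≤ 2 ^ i := by exact_mod_cast h4
  have hs0 : 0 ≤ s := by
    refine le_trans ?_ hs
    rw [sub_nonneg, div_le_one (by positivity)]; linarith
  have hs1 : s ≤ 1 := hs'.trans (by simp)
  have hκ : Real.exp (-4) ≤ s ^ 2 ^ i := exp_neg_four_le_pow h4 (by push_cast; exact hs)
  obtain ⟨m, rfl⟩ : ∃ m, M = i + (m + 1) := ⟨M - i - 1, by omega⟩
  -- Split the row into `j < i`, `j = i` (where `(i - j)⁻¹ = 0`) and `j > i`.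
  rw [hilbertRow, Finset.sum_range_add, Finset.sum_range_succ' _ m]
  have low : 2 ^ i * (Real.exp (-4) * ∑ k ∈ Finset.range i, 1 / ((k : ℝ) + 1)) ≤
      ∑ j ∈ Finset.range i, ((i : ℝ) - j)⁻¹ * ((2 ^ i + 2 ^ j + 1) * s ^ 2 ^ j) := by
    rw [← Finset.sum_range_reflect, Finset.mul_sum, Finset.mul_sum]
    refine Finset.sum_le_sum fun j hj => ?_
    have hj := Finset.mem_range.1 hj
    have e : ((i - 1 - j : ℕ) : ℝ) + 1 = i - j := by
      rw [Nat.cast_sub (by omega), Nat.cast_sub (by omega)]; push_cast; ring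
    have hp : (0 : ℝ) < i - j := by
      rw [sub_pos]; exact_mod_cast hj
    rw [e]
    have hκj : Real.exp (-4) ≤ s ^ 2 ^ j :=
      hκ.trans (pow_le_pow_of_le_one hs0 hs1 (Nat.pow_le_pow_right two_pos hj.le))
    calc 2 ^ i * (Real.exp (-4) * (1 / ((i : ℝ) - j))) =
          ((i : ℝ) - j)⁻¹ * (2 ^ i * Real.exp (-4)) := by ring
      _ ≤ _ := by
        gcongr
        have : (0 : ℝ) < 2 ^ j := by positivity
        linarith
  have high : -(4 * 2 ^ i) ≤ ∑ k ∈ Finset.range m, ((i : ℝ) - (i + (k + 1) : ℕ))⁻¹ *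
      ((2 ^ i + 2 ^ (i + (k + 1)) + 1) * s ^ 2 ^ (i + (k + 1))) := by
    calc -(4 * 2 ^ i) ≤ -(4 * 2 ^ i) * ∑ k ∈ Finset.range m, (1 / 2 : ℝ) ^ (k + 1) := by
          have := sum_range_half_pow_succ_le m
          have hp : (0 : ℝ) < 4 * 2 ^ i := by positivity
          nlinarith
      _ ≤ _ := by
        rw [Finset.mul_sum]
        refine Finset.sum_le_sum fun k _ => ?_
        have e : (i : ℝ) - (i + (k + 1) : ℕ) = -(k + 1) := by push_cast; ring
        rw [e, inv_neg, neg_mul, neg_mul, neg_le_neg_iff]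
        have h1 : ((k : ℝ) + 1)⁻¹ ≤ 1 := inv_le_one_of_one_le₀ (by linarith [k.cast_nonneg (α := ℝ)])
        have h2 : (2 ^ i + 2 ^ (i + (k + 1)) + 1 : ℝ) ≤ 2 * (2 ^ i * 2 ^ (k + 1)) := by
          rw [pow_add, pow_succ]
          have : (1 : ℝ) ≤ 2 ^ k := one_le_pow₀ one_le_two
          nlinarith
        have h3 := pow_two_pow_add_le (d := k + 1) hs0 hs'
        calc ((k : ℝ) + 1)⁻¹ * ((2 ^ i + 2 ^ (i + (k + 1)) + 1) * s ^ 2 ^ (i + (k + 1))) ≤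
              1 * ((2 * (2 ^ i * 2 ^ (k + 1))) * s ^ 2 ^ (i + (k + 1))) := by gcongr
          _ = 2 * 2 ^ i * (2 ^ (k + 1) * s ^ 2 ^ (i + (k + 1))) := by ring
          _ ≤ 2 * 2 ^ i * (2 * (1 / 2) ^ (k + 1)) := by gcongr
          _ = 4 * 2 ^ i * (1 / 2) ^ (k + 1) := by ring
  simp only [add_zero, sub_self, inv_zero, zero_mul]
  linarith

end Rows

/-! ### Divergence of the anti-analytic embedding -/

section Divergence
variable {H : Type*} [NormedAddCommGroup H] [InnerProductSpace ℂ H] [CompleteSpace H]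

theorem volume_annulus {a b : ℝ} (ha : 0 ≤ a) (hab : a ≤ b) :
    volume (ball (0 : ℂ) √b \ closedBall 0 √a) = ENNReal.ofReal (Real.pi * (b - a)) := by
  rcases hab.eq_or_lt with rfl | hlt
  · simp [Set.sdiff_eq_empty.2 ball_subset_closedBall]
  have hpi : (NNReal.pi : ℝ≥0∞) = ENNReal.ofReal Real.pi :=
    (ENNReal.ofReal_coe_nnreal (p := NNReal.pi)).symm
  rw [measure_sdiff (closedBall_subset_ball (Real.sqrt_lt_sqrt ha hlt))
    measurableSet_closedBall.nullMeasurableSet (by simp [Complex.volume_closedBall]; finiteness),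
    Complex.volume_ball, Complex.volume_closedBall,
    ← ENNReal.ofReal_pow (Real.sqrt_nonneg _), ← ENNReal.ofReal_pow (Real.sqrt_nonneg _),
    Real.sq_sqrt (ha.trans hab), Real.sq_sqrt ha, hpi, ← ENNReal.ofReal_mul (ha.trans hab),
    ← ENNReal.ofReal_mul ha, ← ENNReal.ofReal_sub _ (by positivity)]
  congr 1; ring

/-- The squared coordinates of `(Dφ)(z) f(z̄)` for a lacunary test function. The matching exponents of
`z` and `z̄` combine to `|z|²`, so apart from `z ^ 2 ^ i` only real quantities remain. -/
theorem norm_inner_diffOp_sq {e : ℕ → H} (he : Orthonormal ℂ e) {T : H →L[ℂ] H}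
    (hT : ∀ i j : ℕ, inner ℂ (e i) (T (e j)) = (((i : ℝ) - j)⁻¹ : ℝ)) {z : ℂ}
    (hz : z ∈ ball (0 : ℂ) 1) (M : ℕ) (c : ℝ) (i : ℕ) :
    ‖inner ℂ (e i) (diffOp (lacunarySymbol e T) z
      (∑ j ∈ Finset.range M, conj z ^ 2 ^ j • (c : ℂ) • e j))‖ ^ 2 =
      c ^ 2 * ((‖z‖ ^ 2) ^ 2 ^ i * hilbertRow M i (‖z‖ ^ 2) ^ 2) := by
  simp only [smul_smul]
  rw [inner_diffOp_lacunarySymbol_apply_sum he T hz]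
  have : ∑ j ∈ Finset.range M, conj z ^ 2 ^ j * (c : ℂ) * inner ℂ (e i) (T (e j)) *
      ((2 ^ i + 2 ^ j + 1) * z ^ (2 ^ i + 2 ^ j)) =
      (c : ℂ) * (z ^ 2 ^ i * (hilbertRow M i (‖z‖ ^ 2) : ℝ)) := by
    rw [hilbertRow]
    push_cast
    rw [Finset.mul_sum, Finset.mul_sum]
    refine Finset.sum_congr rfl fun j _ => ?_
    have hzz : ((‖z‖ : ℂ) ^ 2) ^ 2 ^ j = z ^ 2 ^ j * conj z ^ 2 ^ j := by
      rw [← mul_pow, Complex.mul_conj, Complex.normSq_eq_norm_sq]; push_cast; rfl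
    rw [hT, hzz, pow_add]
    push_cast
    ring
  rw [this, norm_mul, norm_mul, norm_pow, Complex.norm_real, Complex.norm_real,
    Real.norm_eq_abs, Real.norm_eq_abs, mul_pow, mul_pow, sq_abs, sq_abs]
  ring

/-- The `i`-th coordinate contributes at least a constant times `B ^ 2`, already on the annulus
`1 - 2 / 2 ^ i < |z|² < 1 - 1 / 2 ^ i`, where the row is at least `2 ^ i * B`. -/
theorem le_lintegral_row {M i : ℕ} (hi : 2 ≤ i) (hiM : i < M) {B : ℝ} (hB : 0 ≤ B)
    (hBi : B ≤ Real.exp (-4) * ∑ k ∈ Finset.range i, 1 / ((k : ℝ) + 1) - 4) (c : ℝ) :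
    ENNReal.ofReal (c ^ 2 * (Real.pi * Real.exp (-4) * B ^ 2)) ≤
      ∫⁻ z in ball (0 : ℂ) 1, ENNReal.ofReal
        (c ^ 2 * ((‖z‖ ^ 2) ^ 2 ^ i * hilbertRow M i (‖z‖ ^ 2) ^ 2) * (1 - ‖z‖ ^ 2)) := by
  have h4 : 4 ≤ 2 ^ i := by
    calc 4 = 2 ^ 2 := rfl
      _ ≤ 2 ^ i := Nat.pow_le_pow_right two_pos hi
  have h4' : (4 : ℝ) ≤ 2 ^ i := by exact_mod_cast h4
  set n : ℝ := 2 ^ i with hn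
  have hn0 : 0 < n := by positivity
  have ha : 0 ≤ 1 - 2 / n := by
    rw [sub_nonneg, div_le_one hn0]; linarith
  have hab : 1 - 2 / n ≤ 1 - 1 / n := by gcongr; norm_num
  set A : Set ℂ := ball (0 : ℂ) √(1 - 1 / n) \ closedBall 0 √(1 - 2 / n) with hA
  have hAb : A ⊆ ball 0 1 := by
    refine Set.sdiff_subset.trans (ball_subset_ball (Real.sqrt_le_one.2 ?_))
    simp [hn0.le]
  have hAm : MeasurableSet A := measurableSet_ball.diff measurableSet_closedBall
  have bound : ∀ z ∈ A, c ^ 2 * (Real.exp (-4) * (n * B) ^ 2) * (1 / n) ≤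
      c ^ 2 * ((‖z‖ ^ 2) ^ 2 ^ i * hilbertRow M i (‖z‖ ^ 2) ^ 2) * (1 - ‖z‖ ^ 2) := by
    intro z hz
    rw [hA, Set.mem_sdiff, mem_ball_zero_iff, mem_closedBall_zero_iff, not_le] at hz
    have hs : 1 - 2 / n ≤ ‖z‖ ^ 2 := (Real.sqrt_le_left (norm_nonneg z)).1 hz.2.le
    have hs' : ‖z‖ ^ 2 ≤ 1 - 1 / n := ((Real.lt_sqrt (norm_nonneg z)).1 hz.1).le
    have hκ : Real.exp (-4) ≤ (‖z‖ ^ 2) ^ 2 ^ i :=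
      exp_neg_four_le_pow h4 (by push_cast; exact hs)
    have hrow : n * B ≤ hilbertRow M i (‖z‖ ^ 2) :=
      (mul_le_mul_of_nonneg_left hBi hn0.le).trans (le_hilbertRow hi hiM hs hs')
    have hw : 1 / n ≤ 1 - ‖z‖ ^ 2 := by linarith
    gcongr
  calc _ = ENNReal.ofReal (c ^ 2 * (Real.exp (-4) * (n * B) ^ 2) * (1 / n)) * volume A := by
        rw [hA, volume_annulus ha hab, ← ENNReal.ofReal_mul (by positivity)]
        congr 1
        field_simp
        ring
    _ = ∫⁻ _ in A, ENNReal.ofReal (c ^ 2 * (Real.exp (-4) * (n * B) ^ 2) * (1 / n)) := by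
        rw [setLIntegral_const]
    _ ≤ ∫⁻ z in A, ENNReal.ofReal
        (c ^ 2 * ((‖z‖ ^ 2) ^ 2 ^ i * hilbertRow M i (‖z‖ ^ 2) ^ 2) * (1 - ‖z‖ ^ 2)) :=
        setLIntegral_mono' hAm fun z hz => ENNReal.ofReal_le_ofReal (bound z hz)
    _ ≤ _ := lintegral_mono_set hAb

/-- Half of the `2 * N` coordinates of the test function with `2 * N` terms contribute a fixed multiple
of `B ^ 2 / (2 * N)` each, where `B` is as large as the harmonic sum of length `N` allows. -/
theorem antiAnalyticCarleson_lacunarySymbol {e : ℕ → H} (he : Orthonormal ℂ e) {T : H →L[ℂ] H}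
    (hT : ∀ i j : ℕ, inner ℂ (e i) (T (e j)) = (((i : ℝ) - j)⁻¹ : ℝ)) :
    antiAnalyticCarleson (lacunarySymbol e T) = ∞ := by
  have main : ∀ B : ℝ, 0 ≤ B → ENNReal.ofReal (Real.pi * Real.exp (-4) * B ^ 2 / 2) ≤
      antiAnalyticCarleson (lacunarySymbol e T) := by
    intro B hB
    have hlim : Filter.Tendsto (fun n : ℕ => Real.exp (-4) *
        ∑ k ∈ Finset.range n, 1 / ((k : ℝ) + 1) - 4) Filter.atTop Filter.atTop :=
      Filter.tendsto_atTop_add_const_right _ _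
        (Real.tendsto_sum_range_one_div_nat_succ_atTop.const_mul_atTop (Real.exp_pos _))
    obtain ⟨N, hN⟩ := Filter.eventually_atTop.1
      ((hlim.eventually_ge_atTop B).and (Filter.eventually_ge_atTop 2))
    have hN2 : 2 ≤ N := (hN N le_rfl).2
    have hNpos : (0 : ℝ) < N := by exact_mod_cast (show 0 < N by omega)
    set c : ℝ := (√((2 * N : ℕ) : ℝ))⁻¹ with hc
    have hc2 : c ^ 2 = (2 * N : ℝ)⁻¹ := by
      rw [hc, inv_pow, Real.sq_sqrt (Nat.cast_nonneg _)]; push_cast; rfl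
    have hf := sum_lacunary_mem_normalizedAnalytic he (M := 2 * N) (by omega)
    refine le_trans ?_ (le_iSup₂_of_le _ hf le_rfl)
    have hmeas : ∀ i, Measurable fun z : ℂ => ENNReal.ofReal
        (c ^ 2 * ((‖z‖ ^ 2) ^ 2 ^ i * hilbertRow (2 * N) i (‖z‖ ^ 2) ^ 2) * (1 - ‖z‖ ^ 2)) := by
      intro i
      unfold hilbertRow
      fun_prop
    calc ENNReal.ofReal (Real.pi * Real.exp (-4) * B ^ 2 / 2) =
          ∑ i ∈ Finset.Ico N (2 * N),
            ENNReal.ofReal (c ^ 2 * (Real.pi * Real.exp (-4) * B ^ 2)) := by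
          rw [Finset.sum_const, Nat.card_Ico, show 2 * N - N = N by omega, nsmul_eq_mul,
            ← ENNReal.ofReal_natCast, ← ENNReal.ofReal_mul hNpos.le, hc2]
          congr 1
          field_simp
      _ ≤ ∑ i ∈ Finset.Ico N (2 * N), ∫⁻ z in ball (0 : ℂ) 1, ENNReal.ofReal
            (c ^ 2 * ((‖z‖ ^ 2) ^ 2 ^ i * hilbertRow (2 * N) i (‖z‖ ^ 2) ^ 2) *
              (1 - ‖z‖ ^ 2)) := by
          refine Finset.sum_le_sum fun i hi => ?_
          obtain ⟨h1, h2⟩ := Finset.mem_Ico.1 hi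
          exact le_lintegral_row (hN2.trans h1) h2 hB (hN i h1).1 c
      _ = ∫⁻ z in ball (0 : ℂ) 1, ∑ i ∈ Finset.Ico N (2 * N), ENNReal.ofReal
            (c ^ 2 * ((‖z‖ ^ 2) ^ 2 ^ i * hilbertRow (2 * N) i (‖z‖ ^ 2) ^ 2) *
              (1 - ‖z‖ ^ 2)) := (lintegral_finsetSum _ fun i _ => hmeas i).symm
      _ ≤ _ := by
          refine setLIntegral_mono' measurableSet_ball fun z hz => ?_
          have hw : 0 ≤ 1 - ‖z‖ ^ 2 := by
            have := mem_ball_zero_iff.1 hz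
            nlinarith [norm_nonneg z]
          rw [← ENNReal.ofReal_sum_of_nonneg fun i _ => by positivity]
          refine ENNReal.ofReal_le_ofReal ?_
          rw [← Finset.sum_mul]
          gcongr
          simp only [← norm_inner_diffOp_sq he hT hz]
          exact he.sum_inner_products_le _
  refine ENNReal.eq_top_of_forall_nnreal_le fun r => ?_
  have hk : 0 < Real.pi * Real.exp (-4) := by positivity
  convert main (√(2 * r / (Real.pi * Real.exp (-4)))) (Real.sqrt_nonneg _) using 1
  rw [Real.sq_sqrt (by positivity), mul_div_cancel₀ _ hk.ne']
  simp

end Divergence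
theorem mainTheorem2 (H : Type*) [NormedAddCommGroup H] [InnerProductSpace ℂ H] [CompleteSpace H]
    [TopologicalSpace.SeparableSpace H] (hH : ¬ FiniteDimensional ℂ H) :
    ∃ φ : ℂ → H →L[ℂ] H,
      AnalyticOnNhd ℂ φ (ball 0 1) ∧
      (∃ C : ℝ, ∀ z ∈ ball (0 : ℂ) 1, ‖φ z‖ ≤ C) ∧
      analyticCarleson φ < ∞ ∧
      antiAnalyticCarleson φ = ∞ := by
  obtain ⟨e, he⟩ := exists_orthonormal_nat hH
  obtain ⟨T, hT⟩ := exists_hilbert_matrix he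
  have hφ := analyticOnNhd_lacunarySymbol he T
  have hC : ∀ z ∈ ball (0 : ℂ) 1, ‖lacunarySymbol e T z‖ ≤ ‖T‖ := fun z hz =>
    norm_lacunarySymbol_le he T hz
  exact ⟨lacunarySymbol e T, hφ, ⟨‖T‖, hC⟩,
    (analyticCarleson_le hφ hC).trans_lt ENNReal.ofReal_lt_top,
    antiAnalyticCarleson_lacunarySymbol he hT⟩
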